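/- Let $p$ be a prime. All rings are commutative. A $\delta$-ring is a ring $A$ with a map $\delta:A\to A$ such that $\delta(1)=0$, $\delta(xy)=x^p\delta(y)+\delta(x)y^p+p\,\delta(x)\delta(y)$ and $\delta(x+y)=\delta(x)+\delta(y)+\frac{x^p+y^p-(x+y)^p}{p}$ (the last term denoting the evaluation of the corresponding integral polynomial); $\delta$-ring maps are the ring maps commuting with $\delta$. A $\delta$-ring is perfect if $\varphi(x)=x^p+p\,\delta(x)$ is bijective. Let $\mathrm{Stone}^{\delta,\wedge}$ be the category of Stone $\delta$-rings, i.e. the essential image of the $p$-typical Witt vector functor $W$ from $p$-Boolean algebras ($\mathbb{F}_p$-algebras with $a^p=a$ for all $a$) to (classically) $p$-complete perfect $\delta$-rings with $\delta$-ring maps. A ring map $A\to B$ is $p$-completely faithfully flat if $B\otimes_A^L A/p$ is concentrated in degree $0$ and $A/p\to B/p$ is faithfully flat. A finite family $\{A\to B_i\}_{i\in I}$ of maps of Stone $\delta$-rings (that is, a finite family of maps to $A$ in $(\mathrm{Stone}^{\delta,\wedge})^{\mathrm{op}}$) is a $p$-completely faithfully flat cover if $A\to\prod_{i\in I}B_i$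 is $p$-completely faithfully flat. Let $\tau_{p\text{-fpqc}}$ be the Grothendieck topology on $(\mathrm{Stone}^{\delta,\wedge})^{\mathrm{op}}$ generated by these covers, and let $\tau_{\mathrm{eff}}$ be the Grothendieck topology on the category $\mathrm{ProFin}$ of profinite sets generated by the finite jointly surjective families. Then the following hold. 1. There is an equivalence of categories $\mathrm{ProFin}\simeq(\mathrm{Stone}^{\delta,\wedge})^{\mathrm{op}}$, naturally isomorphic to $S\mapsto\mathrm{Cont}(S,\mathbb{Z}_p)$ (with $\delta(f)=(f-f^p)/p$), whose quasi-inverse is naturally isomorphic, as a functor to topological spaces, to $A\mapsto\mathrm{Spec}(A/p)$, and which is an isomorphism of sites $$(\mathrm{ProFin},\tau_{\mathrm{eff}})\simeq\big((\mathrm{Stone}^{\delta,\wedge})^{\mathrm{op}},\tau_{p\text{-fpqc}}\big),$$ i.e. a sieve is covering on one side if and only if the corresponding sieve on the other side is covering. Moreover, a finite family $\{T_i\to S\}$ of maps of profinite sets is jointly surjective if and only if the corresponding family in $(\mathrm{Stone}^{\delta,\wedge})^{\mathrm{op}}$ is a $p$-completely faithfully flat cover. 2. A map $A\to B$ of Stone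 $\mathbb{F}_p$-algebras (filtered colimits of $\mathbb{F}_p$-algebras $\mathbb{F}_p^{S}$ with $S$ a finite set) is faithfully flat if and only if $\mathrm{Spec}(B)\to\mathrm{Spec}(A)$ is surjective. -/

import Mathlib

open CategoryTheory Opposite

universe u

noncomputable section

/-! ### δ-rings -/

/-- A `δ`-structure (at `p`) on a commutative ring. In the sum rule,
`((x ^ p + y ^ p) - (x + y) ^ p) / p` is the value at `(x, y)` of the integral polynomial
`- ∑_{0 < k < p} (p.choose k / p) X ^ k Y ^ (p - k)`. -/
@[ext]
structure DeltaStructure (p : ℕ) (A : Type u) [CommRing A] where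
  toFun : A → A
  map_one' : toFun 1 = 0
  map_mul' : ∀ x y, toFun (x * y) =
    x ^ p * toFun y + toFun x * y ^ p + (p : A) * toFun x * toFun y
  map_add' : ∀ x y, toFun (x + y) = toFun x + toFun y -
    ∑ k ∈ Finset.Ioo 0 p, x ^ k * y ^ (p - k) * ((p.choose k / p : ℕ) : A)

/-- In a `p`-torsion-free ring, a lift `φ` of Frobenius yields a `δ`-structure
`δ x = (φ x - x ^ p) / p`. -/
def DeltaStructure.ofFrobeniusLift (p : ℕ) [Fact p.Prime] {A : Type u} [CommRing A]
    (tf : ∀ x : A, (p : A) * x = 0 → x = 0) (φ : A →+* A) (δ : A → A)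
    (h : ∀ x, (p : A) * δ x = φ x - x ^ p) : DeltaStructure p A where
  toFun := δ
  map_one' := tf _ (by rw [h]; simp)
  map_mul' x y := by
    refine sub_eq_zero.1 (tf _ ?_)
    have hxy := h (x * y)
    rw [map_mul] at hxy
    linear_combination hxy - x ^ p * h y - y ^ p * h x - (p : A) * δ x * h y
      - (φ y - y ^ p) * h x
  map_add' x y := by
    refine sub_eq_zero.1 (tf _ ?_)
    have hxy := h (x + y)
    rw [map_add, add_pow_prime_eq' (Fact.out : p.Prime)] at hxy
    linear_combination hxy - h x - h y

/-- The category of `δ`-rings (at `p`), with `δ`-ring maps. -/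
structure DeltaRingCat (p : ℕ) : Type (u + 1) where
  carrier : Type u
  [commRing : CommRing carrier]
  delta : DeltaStructure p carrier

namespace DeltaRingCat

variable {p : ℕ}

instance : CoeSort (DeltaRingCat.{u} p) (Type u) := ⟨DeltaRingCat.carrier⟩

attribute [instance] DeltaRingCat.commRing

/-- A `δ`-ring map is a ring map that commutes with `δ`. -/
@[ext]
structure Hom (A B : DeltaRingCat.{u} p) where
  hom : A →+* B
  map_delta : ∀ x, hom (A.delta.toFun x) = B.delta.toFun (hom x)

instance : Category (DeltaRingCat.{u} p) where
  Hom A B := Hom A B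
  id A := ⟨RingHom.id A, fun _ => rfl⟩
  comp f g := ⟨g.hom.comp f.hom, fun x => by simp [f.map_delta, g.map_delta]⟩

/-- The Frobenius lift `φ x = x ^ p + p δ x`. -/
def frobeniusLift (A : DeltaRingCat.{u} p) (x : A) : A := x ^ p + (p : A) * A.delta.toFun x

/-- The ideal `(p)`. -/
abbrev idealP (p : ℕ) (A : Type u) [CommRing A] : Ideal A := Ideal.span {(p : A)}

/-- Reduction modulo `p`, `A ↦ A / p`. -/
def modP (p : ℕ) : DeltaRingCat.{u} p ⥤ CommRingCat.{u} where
  obj A := CommRingCat.of (A ⧸ idealP p A)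
  map {A B} f := CommRingCat.ofHom (Ideal.quotientMap (idealP p B) (Hom.hom f)
    (by simp [idealP, Ideal.span_le]))
  map_id A := by ext x; rfl
  map_comp f g := by ext x; rfl

/-- The functor `A ↦ Spec (A / p)`, with values in topological spaces. -/
def specModP (p : ℕ) : (DeltaRingCat.{u} p)ᵒᵖ ⥤ TopCat.{u} :=
  (modP p).op ⋙ AlgebraicGeometry.Spec.toTop

end DeltaRingCat

/-- `p`-complete (in the classical sense) perfect `δ`-rings: the Frobenius lift is bijective. -/
def isPerfectPComplete (p : ℕ) : ObjectProperty (DeltaRingCat.{u} p) := fun A =>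
  IsAdicComplete (DeltaRingCat.idealP p A) A ∧ Function.Bijective A.frobeniusLift

/-- The category of `p`-complete perfect `δ`-rings with `δ`-ring maps. -/
abbrev PerfDelta (p : ℕ) := (isPerfectPComplete.{u} p).FullSubcategory

/-! ### `p`-Boolean algebras and Witt vectors -/

/-- An `𝔽_p`-algebra is `p`-Boolean if `a ^ p = a` for all `a`. -/
def isPBoolean (p : ℕ) : ObjectProperty (CommAlgCat.{u} (ZMod p)) := fun R =>
  ∀ a : R, a ^ p = a

/-- The category of `p`-Boolean algebras. -/
abbrev PBoolAlg (p : ℕ) := (isPBoolean.{u} p).FullSubcategory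

section Witt

variable (p : ℕ) [Fact p.Prime]

lemma PBoolAlg.subsingleton_or (R : PBoolAlg.{u} p) :
    Subsingleton R.obj ∨ ∃ _ : CharP R.obj p, PerfectRing R.obj p := by
  rcases subsingleton_or_nontrivial R.obj with h | h
  · exact Or.inl h
  · have hc : CharP R.obj p := charP_of_injective_algebraMap (algebraMap (ZMod p) R.obj).injective p
    refine Or.inr ⟨hc, ⟨?_⟩⟩
    have : (fun x : R.obj => x ^ p) = id := funext fun a => R.property a
    rw [this]
    exact Function.bijective_id

lemma witt_subsingleton (p : ℕ) (R : Type u) [CommRing R] [Subsingleton R] :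
    Subsingleton (WittVector p R) :=
  ⟨fun _ _ => WittVector.ext fun _ => Subsingleton.elim _ _⟩

lemma PBoolAlg.witt_torsionFree (R : PBoolAlg.{u} p) (x : WittVector p R.obj)
    (hx : (p : WittVector p R.obj) * x = 0) : x = 0 := by
  rcases R.subsingleton_or with h | ⟨_, _⟩
  · exact (witt_subsingleton p R.obj).elim _ _
  · exact WittVector.eq_zero_of_p_mul_eq_zero x (by rw [mul_comm]; exact hx)

lemma PBoolAlg.witt_frobenius (R : PBoolAlg.{u} p) (x : WittVector p R.obj) :
    WittVector.frobenius x = x := by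
  rcases R.subsingleton_or with h | ⟨_, _⟩
  · exact (witt_subsingleton p R.obj).elim _ _
  · ext n
    rw [WittVector.coeff_frobenius_charP]
    exact R.property _

lemma PBoolAlg.witt_dvd (R : PBoolAlg.{u} p) (x : WittVector p R.obj) :
    ∃ y, (p : WittVector p R.obj) * y = WittVector.frobenius x - x ^ p := by
  rcases R.subsingleton_or with h | ⟨_, _⟩
  · exact ⟨0, (witt_subsingleton p R.obj).elim _ _⟩
  · have : WittVector.frobenius x - x ^ p ∈ Ideal.span {(p : WittVector p R.obj)} := by
      rw [WittVector.mem_span_p_iff_coeff_zero_eq_zero]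
      change (WittVector.constantCoeff : WittVector p R.obj →+* R.obj)
        (WittVector.frobenius x - x ^ p) = 0
      rw [map_sub, map_pow, sub_eq_zero]
      exact WittVector.coeff_frobenius_charP p x 0
    obtain ⟨y, hy⟩ := Ideal.mem_span_singleton.1 this
    exact ⟨y, hy.symm⟩

/-- The `δ`-structure of `W(R)`, whose Frobenius lift is the Witt vector Frobenius. -/
def PBoolAlg.wittDelta (R : PBoolAlg.{u} p) : DeltaStructure p (WittVector p R.obj) :=
  DeltaStructure.ofFrobeniusLift p (R.witt_torsionFree p) WittVector.frobenius
    (fun x => (R.witt_dvd p x).choose) (fun x => (R.witt_dvd p x).choose_spec)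

lemma PBoolAlg.wittDelta_spec (R : PBoolAlg.{u} p) (x : WittVector p R.obj) :
    (p : WittVector p R.obj) * (R.wittDelta p).toFun x = WittVector.frobenius x - x ^ p :=
  (R.witt_dvd p x).choose_spec

/-- The `p`-typical Witt vectors, as a functor from `p`-Boolean algebras to `p`-complete perfect
`δ`-rings. -/
def wittFunctor : PBoolAlg.{u} p ⥤ PerfDelta.{u} p where
  obj R :=
    { obj := { carrier := WittVector p R.obj, delta := R.wittDelta p }
      property := by
        constructor
        · rcases R.subsingleton_or with h | ⟨_, _⟩
          · have := witt_subsingleton p R.obj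
            exact inferInstanceAs
              (IsAdicComplete (DeltaRingCat.idealP p (WittVector p R.obj)) (WittVector p R.obj))
          · exact WittVector.isAdicCompleteIdealSpanP
        · have : DeltaRingCat.frobeniusLift (p := p)
              { carrier := WittVector p R.obj, delta := R.wittDelta p } = id := by
            funext x
            change x ^ p + (p : WittVector p R.obj) * (R.wittDelta p).toFun x = x
            rw [R.wittDelta_spec p, R.witt_frobenius p]
            ring
          rw [this]
          exact Function.bijective_id }
  map {R R'} f := ObjectProperty.homMk
    { hom := WittVector.map (f.hom.hom : R.obj →+* R'.obj)
      map_delta := fun x => by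
        change WittVector.map (f.hom.hom : R.obj →+* R'.obj) ((R.wittDelta p).toFun x) =
          (R'.wittDelta p).toFun (WittVector.map (f.hom.hom : R.obj →+* R'.obj) x)
        refine sub_eq_zero.1 (R'.witt_torsionFree p _ ?_)
        have h := congrArg (WittVector.map (f.hom.hom : R.obj →+* R'.obj)) (R.wittDelta_spec p x)
        have h' := R'.wittDelta_spec p (WittVector.map (f.hom.hom : R.obj →+* R'.obj) x)
        rw [map_mul, map_natCast, map_sub, map_pow, R.witt_frobenius p] at h
        rw [R'.witt_frobenius p] at h'
        rw [mul_sub, h, h', sub_self] }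
  map_id R := by
    apply ObjectProperty.hom_ext
    apply DeltaRingCat.Hom.ext
    ext x n
    rfl
  map_comp f g := by
    apply ObjectProperty.hom_ext
    apply DeltaRingCat.Hom.ext
    ext x n
    rfl

/-- The category of Stone `δ`-rings: the essential image of the Witt vector functor from
`p`-Boolean algebras to `p`-complete perfect `δ`-rings. -/
abbrev StoneDelta := (wittFunctor.{u} p).EssImageSubcategory

/-- The inclusion of Stone `δ`-rings into `δ`-rings. -/
abbrev StoneDelta.incl : StoneDelta.{u} p ⥤ DeltaRingCat.{u} p :=
  (wittFunctor.{u} p).essImage.ι ⋙ (isPerfectPComplete.{u} p).ι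

/-! ### The functor `Cont(-, ℤ_p)` -/

lemma padicInt_norm_sub_pow_div (x : ℤ_[p]) : ‖((x - x ^ p : ℤ_[p]) : ℚ_[p]) / p‖ ≤ 1 := by
  have h : x - x ^ p ∈ RingHom.ker (PadicInt.toZMod (p := p)) := by
    rw [RingHom.mem_ker, map_sub, map_pow, ZMod.pow_card, sub_self]
  rw [PadicInt.ker_toZMod, PadicInt.maximalIdeal_eq_span_p, Ideal.mem_span_singleton] at h
  obtain ⟨y, hy⟩ := h
  have hp : (p : ℚ_[p]) ≠ 0 := by exact_mod_cast (Fact.out : p.Prime).ne_zero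
  rw [hy, PadicInt.coe_mul, PadicInt.coe_natCast, mul_div_cancel_left₀ _ hp]
  exact y.2

/-- The `δ`-structure on `Cont(S, ℤ_p)` whose Frobenius lift is the identity:
`δ f = (f - f ^ p) / p`. -/
def contDelta (S : Type u) [TopologicalSpace S] : DeltaStructure p C(S, ℤ_[p]) :=
  DeltaStructure.ofFrobeniusLift p
    (fun f hf => by
      ext s
      have h := congrArg (fun g : C(S, ℤ_[p]) => g s) hf
      have hp : (p : ℤ_[p]) ≠ 0 := by exact_mod_cast (Fact.out : p.Prime).ne_zero
      have h2 : (p : ℤ_[p]) * f s = 0 := by simpa using h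
      simpa [hp] using h2)
    (RingHom.id _)
    (fun f => ⟨fun s => ⟨((f s - f s ^ p : ℤ_[p]) : ℚ_[p]) / p, padicInt_norm_sub_pow_div p (f s)⟩,
      Continuous.subtype_mk (by
        have : Continuous fun s => f s - f s ^ p := by fun_prop
        exact (continuous_subtype_val.comp this).div_const _) _⟩)
    (fun f => by
      ext s
      have hp : (p : ℚ_[p]) ≠ 0 := by exact_mod_cast (Fact.out : p.Prime).ne_zero
      apply Subtype.ext
      change ((p : ℤ_[p]) : ℚ_[p]) * (((f s - f s ^ p : ℤ_[p]) : ℚ_[p]) / p) = _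
      rw [PadicInt.coe_natCast, mul_div_cancel₀ _ hp]
      rfl)

/-- The functor `S ↦ Cont(S, ℤ_p)`, acting on maps by precomposition. -/
def contFunctor : Profinite.{u} ⥤ (DeltaRingCat.{u} p)ᵒᵖ where
  obj S := op { carrier := C(S, ℤ_[p]), delta := contDelta p S }
  map {S T} f := Quiver.Hom.op
    (show DeltaRingCat.Hom (p := p) { carrier := C(T, ℤ_[p]), delta := contDelta p T }
        { carrier := C(S, ℤ_[p]), delta := contDelta p S } from
      { hom := (ContinuousMap.compRightAlgHom ℤ_[p] ℤ_[p] f.hom.hom : C(T, ℤ_[p]) →+* C(S, ℤ_[p]))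
        map_delta := fun _ => rfl })
  map_id _ := rfl
  map_comp _ _ := rfl

end Witt

/-! ### The two sites -/

/-- A ring map `f : A → B` is `I`-completely faithfully flat if `B ⊗ᴸ_A A/I` is concentrated in
degree `0` and `A / I → B / I B` is faithfully flat. -/
def IsCompletelyFaithfullyFlat {A B : Type u} [CommRing A] [CommRing B] (I : Ideal A)
    (f : A →+* B) : Prop :=
  (letI := f.toAlgebra
    ∀ n : ℕ, Limits.IsZero (((Tor (ModuleCat.{u} A) (n + 1)).obj (ModuleCat.of A B)).obj
      (ModuleCat.of A (A ⧸ I)))) ∧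
  (Ideal.quotientMap (I.map f) f Ideal.le_comap_map).FaithfullyFlat

/-- A family of maps `T i ⟶ S` of profinite sets is jointly surjective. -/
def IsJointlySurjective {ι : Type} {S : Profinite.{u}} {T : ι → Profinite.{u}}
    (f : ∀ i, T i ⟶ S) : Prop :=
  ∀ s : S, ∃ (i : ι) (t : T i), f i t = s

/-- The finite jointly surjective covers of profinite sets. -/
def effPrecoverage : Precoverage Profinite.{u} where
  coverings S := { R | ∃ (ι : Type) (_ : Finite ι) (T : ι → Profinite.{u}) (f : ∀ i, T i ⟶ S),
    R = Presieve.ofArrows T f ∧ IsJointlySurjective f }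

/-- The Grothendieck topology on profinite sets defined by finite jointly surjective covers. -/
def tauEff : GrothendieckTopology Profinite.{u} := effPrecoverage.toGrothendieck

section

variable (p : ℕ) [Fact p.Prime]

/-- The ring map underlying a morphism in the opposite of the category of Stone `δ`-rings. -/
def StoneDelta.ringHom {X Y : (StoneDelta.{u} p)ᵒᵖ} (f : Y ⟶ X) :
    X.unop.obj.obj →+* Y.unop.obj.obj :=
  DeltaRingCat.Hom.hom ((StoneDelta.incl p).map f.unop)

variable {p} in
/-- A family of maps `Y i ⟶ X` in `(Stone^{δ,∧})ᵒᵖ`, given by maps `A ⟶ B i` of Stone `δ`-rings,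
is a `p`-completely faithfully flat cover if `A → ∏ i, B i` is `p`-completely faithfully flat. -/
def IsPCompletelyFaithfullyFlatCover {ι : Type} {X : (StoneDelta.{u} p)ᵒᵖ}
    {Y : ι → (StoneDelta.{u} p)ᵒᵖ} (f : ∀ i, Y i ⟶ X) : Prop :=
  IsCompletelyFaithfullyFlat (DeltaRingCat.idealP p X.unop.obj.obj)
    (RingHom.pi fun i => StoneDelta.ringHom p (f i))

/-- The finite `p`-completely faithfully flat covers in `(Stone^{δ,∧})ᵒᵖ`. -/
def pfpqcPrecoverage : Precoverage (StoneDelta.{u} p)ᵒᵖ where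
  coverings X := { R | ∃ (ι : Type) (_ : Finite ι) (Y : ι → (StoneDelta.{u} p)ᵒᵖ)
    (f : ∀ i, Y i ⟶ X), R = Presieve.ofArrows Y f ∧ IsPCompletelyFaithfullyFlatCover f }

/-- The `p`-completely faithfully flat topology on `(Stone^{δ,∧})ᵒᵖ`. -/
def tauPfpqc : GrothendieckTopology (StoneDelta.{u} p)ᵒᵖ := (pfpqcPrecoverage p).toGrothendieck

end

/-- An equivalence of categories is an isomorphism of sites if it and its quasi-inverse identify
the covering sieves of the two topologies. -/
def IsIsoOfSites {C D : Type*} [Category* C] [Category* D] (e : C ≌ D)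
    (J : GrothendieckTopology C) (K : GrothendieckTopology D) : Prop :=
  (∀ (X : C) (R : Sieve X), R ∈ J X ↔ R.functorPushforward e.functor ∈ K (e.functor.obj X)) ∧
  (∀ (Y : D) (R : Sieve Y), R ∈ K Y ↔ R.functorPushforward e.inverse ∈ J (e.inverse.obj Y))

/-- Stone `k`-algebras: filtered colimits of the `k`-algebras `k ^ S` with `S` a finite set. -/
def isStoneAlgebra (k : Type) [CommRing k] : ObjectProperty (CommAlgCat.{u} k) :=
  ObjectProperty.ind.{u} fun R =>
    ∃ (S : Type u) (_ : Finite S), Nonempty (CommAlgCat.of k (S → k) ≅ R)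

end

/-!
Everything reduces to the points of spectra modulo `p`.

A `p`-Boolean ring `R` has totally separated spectrum, since every basic open set is defined by an
idempotent `a ^ (p - 1)`, and all its residue fields are `𝔽_p`; so `R` is the ring of locally
constant `𝔽_p`-valued functions on the profinite set `Spec R` (`bijective_residueHom`). Its local
rings are fields, so every ring map out of `R` is flat, and it is faithfully flat exactly when it is
surjective on spectra (`RingHom.faithfullyFlat_iff_of_pow_eq`). Stone `𝔽_p`-algebras are `p`-Boolean
(`isStoneAlgebra.pow_eq`), which gives the statement about them.

For a profinite set `S`, evaluation at points and `W(𝔽_p) = ℤ_p` identify `W(Cont(S, 𝔽_p))` with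
`Cont(S, ℤ_p)` (`bijective_wittToCont`): a family of Witt vectors over `𝔽_p` is `p`-adically
continuous if and only if all its coefficients are locally constant. Both rings are `p`-torsion-free
with identity Frobenius lift, so ring maps between them are `δ`-ring maps. Hence
`S ↦ Cont(S, ℤ_p)` takes values in Stone `δ`-rings and is essentially surjective. It is fully
faithful because
`S = Spec (Cont(S, ℤ_p) / p)` (`bijective_pointModP`) and because ring maps to `ℤ_p` that agree
modulo `p` are equal when `x ≡ x ^ p` modulo `p` in the source (`padicInt_ringHom_ext`).

For the covers, a Stone `δ`-ring `A` is `p`-torsion-free and `A / p` is `p`-Boolean. The resolution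
`0 ⟶ A ⟶ A ⟶ A / p ⟶ 0` shows that the higher `Tor` groups vanish, and flatness modulo `p` is
automatic, so a finite family is a `p`-completely faithfully flat cover if and only if it is jointly
surjective on spectra modulo `p` (`isPCompletelyFaithfullyFlatCover_iff`), that is, on profinite
sets. The two topologies then have corresponding generators.
-/

noncomputable section

/-! ### `p`-Boolean rings -/

section PBoolean

variable {p : ℕ} [Fact p.Prime] {R : Type*} [CommRing R]

lemma isIdempotentElem_pow_sub_one {a : R} (ha : a ^ p = a) : IsIdempotentElem (a ^ (p - 1)) := by
  have h1 : 1 ≤ p := (Fact.out : p.Prime).one_le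
  have hp : a ^ (p - 1) * a = a := by rw [pow_sub_one_mul (by omega), ha]
  have h2 : p - 1 = (p - 2) + 1 := by have := (Fact.out : p.Prime).two_le; omega
  change a ^ (p - 1) * a ^ (p - 1) = a ^ (p - 1)
  nth_rewrite 2 [h2]
  rw [pow_succ', ← mul_assoc, hp, ← pow_succ', ← h2]

lemma isClopen_basicOpen_of_pow_eq {a : R} (ha : a ^ p = a) :
    IsClopen (PrimeSpectrum.basicOpen a : Set (PrimeSpectrum R)) := by
  have h2 := (Fact.out : p.Prime).two_le
  rw [← PrimeSpectrum.basicOpen_pow a (p - 1) (by omega)]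
  exact PrimeSpectrum.isClopen_iff.2 ⟨_, isIdempotentElem_pow_sub_one ha, rfl⟩

lemma totallySeparatedSpace_primeSpectrum (hR : ∀ a : R, a ^ p = a) :
    TotallySeparatedSpace (PrimeSpectrum R) := by
  refine totallySeparatedSpace_of_t0_of_basis_clopen
    (PrimeSpectrum.isTopologicalBasis_basic_opens.of_isOpen_of_subset (fun s hs => hs.isOpen) ?_)
  rintro _ ⟨a, rfl⟩
  exact isClopen_basicOpen_of_pow_eq (hR a)

lemma isField_of_isLocalRing_of_pow_eq [IsLocalRing R] (hR : ∀ a : R, a ^ p = a) : IsField R where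
  exists_pair_ne := ⟨0, 1, zero_ne_one⟩
  mul_comm := mul_comm
  mul_inv_cancel {a} ha := by
    have h2 := (Fact.out : p.Prime).two_le
    have he := isIdempotentElem_pow_sub_one (hR a)
    rcases IsLocalRing.isUnit_or_isUnit_one_sub_self (a ^ (p - 1)) with h | h
    · exact ⟨a ^ (p - 2), by
        rw [← pow_succ', ← (h.mul_left_cancel (he.trans (mul_one _).symm))]; congr 1; omega⟩
    · have h0 : a ^ (p - 1) = 0 := h.mul_left_cancel (by rw [sub_mul, he.eq]; simp)
      exact absurd (by rw [← hR a, ← pow_sub_one_mul (by omega), h0, zero_mul]) ha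

/-- The localizations of the source at its primes are fields, so every module over it is flat. -/
lemma RingHom.flat_of_pow_eq {R S : Type u} [CommRing R] [CommRing S] (hR : ∀ a : R, a ^ p = a)
    (f : R →+* S) : f.Flat := by
  refine RingHom.Flat.ofLocalizationPrime f fun P _ => RingHom.Flat.of_isField
    (isField_of_isLocalRing_of_pow_eq (p := p) fun x => ?_) _
  obtain ⟨a, s, rfl⟩ := IsLocalization.exists_mk'_eq (P.comap f).primeCompl x
  rw [← IsLocalization.mk'_pow, hR]
  congr 1
  exact Subtype.ext (hR _)

lemma RingHom.faithfullyFlat_iff_of_pow_eq {R S : Type u} [CommRing R] [CommRing S]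
    (hR : ∀ a : R, a ^ p = a) (f : R →+* S) :
    f.FaithfullyFlat ↔ Function.Surjective (PrimeSpectrum.comap f) := by
  rw [RingHom.FaithfullyFlat.iff_flat_and_comap_surjective, and_iff_right (flat_of_pow_eq hR f)]

omit [Fact p.Prime] in
lemma pow_eq_of_iso {A B : CommAlgCat.{u} (ZMod p)} (e : A ≅ B) (h : ∀ a : A, a ^ p = a) (b : B) :
    b ^ p = b := by
  have := congrArg (fun x => e.hom.hom x) (h (e.inv.hom b))
  have h2 : e.hom.hom (e.inv.hom b) = b := by
    rw [← CommAlgCat.comp_apply, e.inv_hom_id, CommAlgCat.id_apply]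
  simpa [h2] using this

/-- The `𝔽_p`-subalgebra of the elements with `a ^ p = a`. -/
def fixedSubalgebra (p : ℕ) [Fact p.Prime] (A : Type*) [CommRing A] [Algebra (ZMod p) A] :
    Subalgebra (ZMod p) A where
  carrier := {a | a ^ p = a}
  mul_mem' ha hb := by simp_all [mul_pow]
  add_mem' {a b} ha hb := by
    rcases subsingleton_or_nontrivial A with h | h
    · exact Subsingleton.elim _ _
    · have : CharP A p := charP_of_injective_algebraMap (algebraMap (ZMod p) A).injective p
      simp_all [add_pow_char]
  algebraMap_mem' r := by simp [← map_pow]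

/-- The colimit cocone of a presentation by the algebras `𝔽_p ^ S` factors through the subalgebra of
the elements with `a ^ p = a`, which is therefore everything. -/
lemma isStoneAlgebra.pow_eq {A : CommAlgCat.{u} (ZMod p)} (hA : isStoneAlgebra (ZMod p) A)
    (a : A) : a ^ p = a := by
  obtain ⟨J, _, _, pres, h⟩ := hA
  have hpow (j : J) (x : pres.diag.obj j) : x ^ p = x := by
    obtain ⟨S, _, ⟨e⟩⟩ := h j
    refine pow_eq_of_iso e (fun a => ?_) x
    ext s
    exact ZMod.pow_card (a s)
  -- the cocone with the fixed subalgebra as its point, so that `A ⟶ fixedSubalgebra p A ⟶ A` is the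
  -- identity
  let c : Limits.Cocone pres.diag :=
    { pt := CommAlgCat.of (ZMod p) (fixedSubalgebra p A)
      ι :=
        { app j := CommAlgCat.ofHom ((pres.ι.app j).hom.codRestrict (fixedSubalgebra p A)
            fun x => by
              change ((pres.ι.app j).hom x) ^ p = (pres.ι.app j).hom x
              rw [← map_pow, hpow])
          naturality i j f := by
            ext x
            apply Subtype.ext
            exact congrArg (fun g => g.hom x) (pres.ι.naturality f) } }
  have hc : pres.isColimit.desc c ≫ CommAlgCat.ofHom (fixedSubalgebra p A).val = 𝟙 A := by
    refine pres.isColimit.hom_ext fun j => ?_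
    rw [← Category.assoc, pres.isColimit.fac]
    rfl
  have := congrArg (fun g => g.hom a) hc
  have h2 : ((pres.isColimit.desc c).hom a : fixedSubalgebra p A).1 = a := this
  have h3 := ((pres.isColimit.desc c).hom a : fixedSubalgebra p A).2
  rw [h2] at h3
  exact h3

lemma isReduced_of_pow_eq (hR : ∀ a : R, a ^ p = a) : IsReduced R where
  eq_zero a := by
    rintro ⟨n, hn⟩
    have h (k : ℕ) : a ^ p ^ k = a := by
      induction k with
      | zero => simp
      | succ k ih => rw [pow_succ, pow_mul, ih, hR]
    rw [← h n]
    exact pow_eq_zero_of_le (Nat.lt_pow_self (Fact.out : p.Prime).one_lt).le hn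

section Residue

variable [Algebra (ZMod p) R]

lemma prod_sub_algebraMap (a : R) :
    ∏ c : ZMod p, (a - algebraMap (ZMod p) R c) = a ^ p - a := by
  have h1 : (Polynomial.X ^ p - Polynomial.X : Polynomial (ZMod p)) =
      ∏ c : ZMod p, (Polynomial.X - Polynomial.C c) := by
    have hp := (Fact.out : p.Prime).one_lt
    have hr := FiniteField.roots_X_pow_card_sub_X (ZMod p)
    rw [ZMod.card] at hr
    have hm : (Polynomial.X ^ p - Polynomial.X : Polynomial (ZMod p)).Monic :=
      Polynomial.monic_X_pow_sub (by simpa using hp)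
    rw [← Polynomial.prod_multiset_X_sub_C_of_monic_of_roots_card_eq hm (by
      rw [hr, FiniteField.X_pow_card_sub_X_natDegree_eq _ hp]; simp [ZMod.card]), hr]
    rfl
  have h := congrArg (Polynomial.aeval a) h1
  simpa using h.symm

lemma bijective_algebraMap_quotient (hR : ∀ a : R, a ^ p = a) (P : Ideal R) [P.IsPrime] :
    Function.Bijective (algebraMap (ZMod p) (R ⧸ P)) := by
  refine ⟨(algebraMap (ZMod p) (R ⧸ P)).injective, fun x => ?_⟩
  obtain ⟨a, rfl⟩ := Ideal.Quotient.mk_surjective x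
  have h : ∏ c : ZMod p, (a - algebraMap (ZMod p) R c) ∈ P := by
    rw [prod_sub_algebraMap, hR, sub_self]; exact P.zero_mem
  obtain ⟨c, -, hc⟩ := (Ideal.IsPrime.prod_mem_iff).1 h
  exact ⟨c, (Ideal.Quotient.eq.2 hc).symm⟩

/-- The residue map `R → R / P = 𝔽_p` of a `p`-Boolean ring at a prime `P`. -/
def residueMap (hR : ∀ a : R, a ^ p = a) (P : PrimeSpectrum R) : R →+* ZMod p :=
  ((RingEquiv.ofBijective _ (bijective_algebraMap_quotient hR P.asIdeal)).symm :
    R ⧸ P.asIdeal →+* ZMod p).comp (Ideal.Quotient.mk P.asIdeal)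

lemma residueMap_eq_iff (hR : ∀ a : R, a ^ p = a) (P : PrimeSpectrum R) (a : R) (c : ZMod p) :
    residueMap hR P a = c ↔ a - algebraMap (ZMod p) R c ∈ P.asIdeal := by
  rw [← Ideal.Quotient.eq]
  exact (RingEquiv.ofBijective (algebraMap (ZMod p) (R ⧸ P.asIdeal))
    (bijective_algebraMap_quotient hR P.asIdeal)).symm_apply_eq

lemma isClopen_residueMap_fiber (hR : ∀ a : R, a ^ p = a) (a : R) (c : ZMod p) :
    IsClopen {P | residueMap hR P a = c} := by
  convert! (isClopen_basicOpen_of_pow_eq (hR (a - algebraMap (ZMod p) R c))).compl using 1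
  ext P
  simp [residueMap_eq_iff]

/-- Evaluation at the primes: an element `a` gives the locally constant function
`P ↦ a mod P` on the spectrum. -/
def residueHom (hR : ∀ a : R, a ^ p = a) :
    R →ₐ[ZMod p] LocallyConstant (PrimeSpectrum R) (ZMod p) :=
  AlgHom.mk'
    { toFun a := ⟨fun P => residueMap hR P a,
        (IsLocallyConstant.iff_isOpen_fiber).2 fun c => (isClopen_residueMap_fiber hR a c).isOpen⟩
      map_one' := by ext; simp
      map_mul' a b := by ext; simp
      map_zero' := by ext; simp
      map_add' a b := by ext; simp }
    (fun c a => by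
      ext P
      have : residueMap hR P (algebraMap (ZMod p) R c) = c := by simp [residueMap_eq_iff]
      simp [Algebra.smul_def, this])

/-- Stone duality: a `p`-Boolean ring is the ring of locally constant `𝔽_p`-valued functions on its
spectrum. -/
lemma bijective_residueHom (hR : ∀ a : R, a ^ p = a) : Function.Bijective (residueHom hR) := by
  constructor
  · rw [injective_iff_map_eq_zero]
    intro a ha
    have := isReduced_of_pow_eq hR
    refine (nilpotent_iff_mem_prime.2 fun P hP => ?_ : IsNilpotent a).eq_zero
    have := (residueMap_eq_iff hR ⟨P, hP⟩ a 0).1 (congrArg (fun g => g ⟨P, hP⟩) ha)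
    simpa using this
  · intro g
    have h (c : ZMod p) : ∃ e : R, IsIdempotentElem e ∧ g ⁻¹' {c} = PrimeSpectrum.basicOpen e :=
      PrimeSpectrum.isClopen_iff.1 (g.isLocallyConstant.isClopen_fiber c)
    choose e he hge using h
    -- `e c` is the idempotent that cuts out the clopen fibre of `g` over `c`
    refine ⟨∑ c, algebraMap (ZMod p) R c * e c, ?_⟩
    ext P
    have h1 (c : ZMod p) : residueMap hR P (e c) = if g P = c then 1 else 0 := by
      have hP : g P = c ↔ e c ∉ P.asIdeal := by
        change P ∈ g ⁻¹' {c} ↔ _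
        rw [hge]; rfl
      have h0 := residueMap_eq_iff hR P (e c) 0
      rw [map_zero, sub_zero] at h0
      rcases (IsIdempotentElem.iff_eq_zero_or_one.1 ((he c).map (residueMap hR P))) with h | h
      · rw [if_neg (by rwa [hP, not_not, ← h0]), h]
      · rw [if_pos (by rw [hP, ← h0, h]; exact one_ne_zero), h]
    have h2 (c : ZMod p) : residueMap hR P (algebraMap (ZMod p) R c) = c := by
      simp [residueMap_eq_iff]
    change residueMap hR P _ = _
    simp [h1, h2]

end Residue

end PBoolean

/-! ### Witt vectors of locally constant functions -/

section WittCont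

variable {p : ℕ} [Fact p.Prime]

/-- Under `W(𝔽_p) = ℤ_p`, agreement of the first `n` Witt coefficients is congruence modulo
`p ^ n`. -/
lemma WittVector.coeff_eq_iff_norm_equiv_sub_le (x y : WittVector p (ZMod p)) (n : ℕ) :
    (∀ i < n, x.coeff i = y.coeff i) ↔
      ‖WittVector.equiv p x - WittVector.equiv p y‖ ≤ (p : ℝ) ^ (-n : ℤ) := by
  rw [PadicInt.norm_le_pow_iff_mem_span_pow, WittVector.le_coeff_eq_iff_le_sub_coeff_eq_zero,
    ← WittVector.mem_span_p_pow_iff_le_coeff_eq_zero, Ideal.mem_span_singleton,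
    Ideal.mem_span_singleton, ← map_sub, ← map_dvd_iff (WittVector.equiv p)]
  simp

variable {S : Type*} [TopologicalSpace S]

lemma continuous_wittEquiv (w : S → WittVector p (ZMod p))
    (hw : ∀ n, IsLocallyConstant fun s => (w s).coeff n) :
    Continuous fun s => WittVector.equiv p (w s) := by
  refine continuous_iff_continuousAt.2 fun s => Metric.tendsto_nhds.2 fun ε hε => ?_
  obtain ⟨n, hn⟩ := PadicInt.exists_pow_neg_lt p hε
  have h : ∀ᶠ t in nhds s, ∀ i ∈ Finset.range n, (w t).coeff i = (w s).coeff i :=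
    (Filter.eventually_all_finset _).2 fun i _ => (hw i).eventually_eq s
  filter_upwards [h] with t ht
  rw [dist_eq_norm]
  exact ((WittVector.coeff_eq_iff_norm_equiv_sub_le _ _ n).1 (by simpa using ht)).trans_lt hn

lemma isLocallyConstant_coeff_wittEquiv_symm (g : C(S, ℤ_[p])) (n : ℕ) :
    IsLocallyConstant fun s => ((WittVector.equiv p).symm (g s)).coeff n := by
  refine (IsLocallyConstant.iff_eventually_eq _).2 fun s => ?_
  have hp : (0 : ℝ) < (p : ℝ) ^ (-(n + 1 : ℕ) : ℤ) :=
    zpow_pos (by exact_mod_cast (Fact.out : p.Prime).pos) _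
  filter_upwards [Metric.tendsto_nhds.1 (g.continuous.tendsto s) _ hp] with t ht
  rw [dist_eq_norm] at ht
  exact (WittVector.coeff_eq_iff_norm_equiv_sub_le _ _ (n + 1)).2 (by simpa using ht.le) n
    (Nat.lt_succ_self n)

variable (p S)

/-- The ring map `W(Cont(S, 𝔽_p)) → W(𝔽_p) = ℤ_p` induced by evaluation at `s`. -/
def wittEvalHom (s : S) : WittVector p (LocallyConstant S (ZMod p)) →+* ℤ_[p] :=
  (WittVector.equiv p : WittVector p (ZMod p) →+* ℤ_[p]).comp
    (WittVector.map (LocallyConstant.evalRingHom s))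

/-- The ring map `W(Cont(S, 𝔽_p)) → Cont(S, ℤ_p)`, pointwise given by `wittEvalHom`. -/
def wittToCont : WittVector p (LocallyConstant S (ZMod p)) →+* C(S, ℤ_[p]) where
  toFun x := ⟨fun s => wittEvalHom p S s x, continuous_wittEquiv _ fun n => (x.coeff n).2⟩
  map_one' := by ext; simp
  map_mul' x y := ContinuousMap.ext fun s => map_mul (wittEvalHom p S s) x y
  map_zero' := by ext; simp
  map_add' x y := ContinuousMap.ext fun s => map_add (wittEvalHom p S s) x y

lemma bijective_wittToCont : Function.Bijective (wittToCont p S) := by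
  constructor
  · intro x y h
    ext n s
    have := (WittVector.equiv p).injective (congrArg (fun g : C(S, ℤ_[p]) => g s) h)
    exact congrArg (fun w => w.coeff n) this
  · intro g
    -- the Witt coefficients of the values of `g` are locally constant, so they lift `g`
    refine ⟨WittVector.mk p fun n => ⟨_, isLocallyConstant_coeff_wittEquiv_symm g n⟩, ?_⟩
    ext1 s
    refine (WittVector.equiv p).symm.injective ?_
    refine ((WittVector.equiv p).symm_apply_apply _).trans ?_
    ext n
    rfl

end WittCont

/-! ### Stone `δ`-rings and the functor to them -/

section DeltaHom

variable {p : ℕ}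

/-- Between `δ`-rings whose Frobenius lift is the identity, with `p`-torsion-free target, every ring
map commutes with `δ`. -/
def DeltaRingCat.homOfRingHom {A B : DeltaRingCat.{u} p} (hA : ∀ x, A.frobeniusLift x = x)
    (hB : ∀ x, B.frobeniusLift x = x) (tf : ∀ x : B, (p : B) * x = 0 → x = 0)
    (f : A →+* B) : A ⟶ B where
  hom := f
  map_delta x := by
    refine sub_eq_zero.1 (tf _ ?_)
    have h1 := congrArg f (hA x)
    have h2 := hB (f x)
    simp only [DeltaRingCat.frobeniusLift, map_add, map_mul, map_pow, map_natCast] at h1 h2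
    linear_combination h1 - h2

/-- A ring isomorphism of `p`-torsion-free `δ`-rings whose Frobenius lift is the identity is an
isomorphism of `δ`-rings. -/
def DeltaRingCat.isoOfRingEquiv {A B : DeltaRingCat.{u} p} (hA : ∀ x, A.frobeniusLift x = x)
    (hB : ∀ x, B.frobeniusLift x = x) (tfA : ∀ x : A, (p : A) * x = 0 → x = 0)
    (tfB : ∀ x : B, (p : B) * x = 0 → x = 0) (e : A ≃+* B) : A ≅ B where
  hom := homOfRingHom hA hB tfB e
  inv := homOfRingHom hB hA tfA e.symm
  hom_inv_id := Hom.ext (RingHom.ext e.symm_apply_apply)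
  inv_hom_id := Hom.ext (RingHom.ext e.apply_symm_apply)

/-- The ring isomorphism underlying an isomorphism of `δ`-rings. -/
def DeltaRingCat.ringEquivOfIso {A B : DeltaRingCat.{u} p} (e : A ≅ B) : A ≃+* B :=
  RingEquiv.ofRingHom (Hom.hom e.hom) (Hom.hom e.inv)
    (congrArg Hom.hom e.inv_hom_id) (congrArg Hom.hom e.hom_inv_id)

lemma DeltaRingCat.frobeniusLift_eq_of_iso {A B : DeltaRingCat.{u} p} (e : A ≅ B)
    (hA : ∀ x, A.frobeniusLift x = x) (x : B) : B.frobeniusLift x = x := by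
  obtain ⟨y, rfl⟩ := (ringEquivOfIso e).surjective x
  have h := congrArg (Hom.hom e.hom) (hA y)
  rw [frobeniusLift, map_add, map_mul, map_pow, map_natCast, Hom.map_delta] at h
  exact h

end DeltaHom

section StoneDelta

variable (p : ℕ) [Fact p.Prime]

lemma wittFunctor_frobeniusLift (R : PBoolAlg.{u} p) (x : ((wittFunctor p).obj R).obj) :
    ((wittFunctor p).obj R).obj.frobeniusLift x = x := by
  change WittVector p R.obj at x
  change x ^ p + (p : WittVector p R.obj) * (R.wittDelta p).toFun x = x
  rw [R.wittDelta_spec p, R.witt_frobenius p]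
  ring

lemma contDelta_spec (S : Type u) [TopologicalSpace S] (f : C(S, ℤ_[p])) :
    (p : C(S, ℤ_[p])) * (contDelta p S).toFun f = f - f ^ p := by
  ext s
  have hp : (p : ℚ_[p]) ≠ 0 := by exact_mod_cast (Fact.out : p.Prime).ne_zero
  apply Subtype.ext
  change ((p : ℤ_[p]) : ℚ_[p]) * (((f s - f s ^ p : ℤ_[p]) : ℚ_[p]) / p) = _
  rw [PadicInt.coe_natCast, mul_div_cancel₀ _ hp]
  rfl

lemma contDelta_frobeniusLift (S : Profinite.{u}) (x : ((contFunctor p).obj S).unop) :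
    ((contFunctor p).obj S).unop.frobeniusLift x = x := by
  change C(S, ℤ_[p]) at x
  change x ^ p + (p : C(S, ℤ_[p])) * (contDelta p S).toFun x = x
  rw [contDelta_spec]
  ring

/-- The `p`-Boolean algebra of locally constant `𝔽_p`-valued functions. -/
def PBoolAlg.locallyConstant (S : Type u) [TopologicalSpace S] : PBoolAlg.{u} p where
  obj := CommAlgCat.of (ZMod p) (LocallyConstant S (ZMod p))
  property a := LocallyConstant.ext fun s => ZMod.pow_card (a s)

/-- `wittToCont` as a ring isomorphism. -/
def wittContEquiv (S : Profinite.{u}) :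
    ((wittFunctor p).obj (PBoolAlg.locallyConstant p S)).obj ≃+* ((contFunctor p).obj S).unop :=
  RingEquiv.ofBijective (wittToCont p S) (bijective_wittToCont p S)

lemma contFunctor_torsionFree (S : Profinite.{u}) (x : ((contFunctor p).obj S).unop)
    (hx : (p : ((contFunctor p).obj S).unop) * x = 0) : x = 0 := by
  rw [← (wittContEquiv p S).symm.map_eq_zero_iff]
  refine PBoolAlg.witt_torsionFree p _ _ ?_
  have := congrArg (wittContEquiv p S).symm hx
  rw [map_mul, map_natCast, map_zero] at this
  exact this

/-- `W(Cont(S, 𝔽_p)) ≅ Cont(S, ℤ_p)` as `δ`-rings. -/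
def wittContIso (S : Profinite.{u}) :
    ((wittFunctor p).obj (PBoolAlg.locallyConstant p S)).obj ≅ ((contFunctor p).obj S).unop :=
  DeltaRingCat.isoOfRingEquiv (wittFunctor_frobeniusLift p _) (contDelta_frobeniusLift p S)
    (PBoolAlg.witt_torsionFree p _) (contFunctor_torsionFree p S) (wittContEquiv p S)

lemma isPerfectPComplete_cont (S : Profinite.{u}) :
    isPerfectPComplete p ((contFunctor p).obj S).unop := by
  constructor
  · have := ((wittFunctor p).obj (PBoolAlg.locallyConstant p S)).property.1
    rw [← IsAdicComplete.congr_ringEquiv _ (wittContEquiv p S)] at this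
    simpa [DeltaRingCat.idealP, Ideal.map_span] using this
  · rw [show ((contFunctor p).obj S).unop.frobeniusLift = id from
      funext (contDelta_frobeniusLift p S)]
    exact Function.bijective_id

/-- The functor `S ↦ Cont(S, ℤ_p)`, with values in `p`-complete perfect `δ`-rings. -/
def contPerf : Profinite.{u}ᵒᵖ ⥤ PerfDelta.{u} p :=
  (isPerfectPComplete p).lift (contFunctor p).leftOp fun S => isPerfectPComplete_cont p S.unop

/-- The functor `S ↦ Cont(S, ℤ_p)`, with values in Stone `δ`-rings. -/
def contStone : Profinite.{u} ⥤ (StoneDelta.{u} p)ᵒᵖ :=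
  ((wittFunctor p).essImage.lift (contPerf p) fun S =>
    ⟨PBoolAlg.locallyConstant p S.unop,
      ⟨(isPerfectPComplete p).isoMk (wittContIso p S.unop)⟩⟩).rightOp

/-- `contStone` lifts `contFunctor` along the inclusion. -/
def contStoneCompIncl : contStone p ⋙ (StoneDelta.incl p).op ≅ contFunctor.{u} p :=
  NatIso.ofComponents fun S => Iso.refl _

variable {p}

lemma StoneDelta.exists_iso (X : StoneDelta.{u} p) :
    ∃ R : PBoolAlg.{u} p, Nonempty (((wittFunctor p).obj R).obj ≅ X.obj.obj) := by
  obtain ⟨R, ⟨e⟩⟩ := X.property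
  exact ⟨R, ⟨(isPerfectPComplete p).ι.mapIso e⟩⟩

lemma StoneDelta.frobeniusLift_eq (X : StoneDelta.{u} p) (x : X.obj.obj) :
    X.obj.obj.frobeniusLift x = x := by
  obtain ⟨R, ⟨e⟩⟩ := X.exists_iso
  exact DeltaRingCat.frobeniusLift_eq_of_iso e (wittFunctor_frobeniusLift p R) x

lemma StoneDelta.torsionFree (X : StoneDelta.{u} p) (x : X.obj.obj)
    (hx : (p : X.obj.obj) * x = 0) : x = 0 := by
  obtain ⟨R, ⟨e⟩⟩ := X.exists_iso
  rw [← (DeltaRingCat.ringEquivOfIso e).symm.map_eq_zero_iff]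
  refine PBoolAlg.witt_torsionFree p _ _ ?_
  have := congrArg (DeltaRingCat.ringEquivOfIso e).symm hx
  rw [map_mul, map_natCast, map_zero] at this
  exact this

lemma StoneDelta.quotient_pow_eq (X : StoneDelta.{u} p)
    (a : X.obj.obj ⧸ DeltaRingCat.idealP p X.obj.obj) : a ^ p = a := by
  obtain ⟨x, rfl⟩ := Ideal.Quotient.mk_surjective a
  rw [← map_pow, eq_comm, Ideal.Quotient.eq, Ideal.mem_span_singleton]
  exact ⟨X.obj.obj.delta.toFun x, by
    have := X.frobeniusLift_eq x
    rw [DeltaRingCat.frobeniusLift] at this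
    linear_combination -this⟩

/-- A Stone `δ`-ring `W(R)` is `Cont(S, ℤ_p)` for `S` the spectrum of `R`. -/
instance : (contStone.{u} p).EssSurj where
  mem_essImage X := by
    obtain ⟨R, ⟨e⟩⟩ := X.unop.property
    have hR : ∀ a : R.obj, a ^ p = a := R.property
    have := totallySeparatedSpace_primeSpectrum hR
    let S : Profinite.{u} := Profinite.of (PrimeSpectrum R.obj)
    let e1 : R ≅ PBoolAlg.locallyConstant p S := (isPBoolean p).isoMk
      (CommAlgCat.isoMk (AlgEquiv.ofBijective (residueHom hR) (bijective_residueHom hR)))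
    let e2 : X.unop.obj ≅ ((contStone p).obj S).unop.obj :=
      e.symm ≪≫ (wittFunctor p).mapIso e1 ≪≫ (isPerfectPComplete p).isoMk (wittContIso p S)
    exact ⟨S, ⟨((wittFunctor p).essImage.isoMk e2).op⟩⟩

end StoneDelta

/-! ### Vanishing of `Tor` against a quotient by a nonzerodivisor -/

section TwoTerm

open Limits

universe v

variable {C : Type u} [Category.{v} C] [Abelian C]

/-- The chain complex `X₁ ⟶ X₂` of a short complex `X₁ ⟶ X₂ ⟶ X₃`, with `X₂` in degree `0`. -/
def twoTermComplex (S : ShortComplex C) : ChainComplex C ℕ :=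
  HomologicalComplex.double S.f (c := ComplexShape.down ℕ) (i₀ := 1) (i₁ := 0) (by simp)

/-- The term of degree `1` of `twoTermComplex S`. -/
def twoTermXOne (S : ShortComplex C) : (twoTermComplex S).X 1 ≅ S.X₁ :=
  HomologicalComplex.doubleXIso₀ _ _

/-- The term of degree `0` of `twoTermComplex S`. -/
def twoTermXZero (S : ShortComplex C) : (twoTermComplex S).X 0 ≅ S.X₂ :=
  HomologicalComplex.doubleXIso₁ _ _ (by simp)

lemma twoTermComplex_d (S : ShortComplex C) :
    (twoTermComplex S).d 1 0 = (twoTermXOne S).hom ≫ S.f ≫ (twoTermXZero S).inv :=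
  HomologicalComplex.double_d _ _ (by simp)

lemma twoTermXOne_hom_comp_f (S : ShortComplex C) :
    (twoTermXOne S).hom ≫ S.f = (twoTermComplex S).d 1 0 ≫ (twoTermXZero S).hom := by
  simp [twoTermComplex_d]

lemma isZero_twoTermComplex_X (S : ShortComplex C) (n : ℕ) :
    IsZero ((twoTermComplex S).X (n + 2)) :=
  HomologicalComplex.isZero_double_X _ _ _ (by simp) (by simp)

lemma ChainComplex.exactAt_one_of_mono {K : ChainComplex C ℕ} (h : IsZero (K.X 2))
    [Mono (K.d 1 0)] : K.ExactAt 1 := by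
  rw [HomologicalComplex.exactAt_iff' _ 2 1 0 (by simp) (by simp)]
  exact (ShortComplex.exact_iff_mono _ (h.eq_of_src _ _)).2 ‹_›

lemma ChainComplex.exactAt_of_isZero {K : ChainComplex C ℕ} {n : ℕ} (h : IsZero (K.X n)) :
    K.ExactAt n :=
  ShortComplex.exact_of_isZero_X₂ _ h

/-- A short exact sequence with projective `X₁` and `X₂` is a projective resolution of `X₃`. -/
def twoTermResolution {S : ShortComplex C} (hS : S.ShortExact) [Projective S.X₁]
    [Projective S.X₂] : ProjectiveResolution S.X₃ where
  complex := twoTermComplex S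
  projective n := by
    match n with
    | 0 => exact Projective.of_iso (twoTermXZero S).symm ‹_›
    | 1 => exact Projective.of_iso (twoTermXOne S).symm ‹_›
    | n + 2 => exact (isZero_twoTermComplex_X S n).projective
  π := (ChainComplex.toSingle₀Equiv _ _).symm ⟨(twoTermXZero S).hom ≫ S.g, by
    rw [twoTermComplex_d]
    simp⟩
  quasiIso := ⟨fun n => by
    cases n with
    | zero =>
      rw [ChainComplex.quasiIsoAt₀_iff, ShortComplex.quasiIso_iff_of_zeros']
      · have := hS.epi_g
        refine (ShortComplex.exact_and_epi_g_iff_of_iso ?_).2 ⟨hS.exact, this⟩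
        refine ShortComplex.isoMk (twoTermXOne S) (twoTermXZero S) (Iso.refl _) ?_ ?_
        · exact twoTermXOne_hom_comp_f S
        · refine Eq.trans ?_ (Category.comp_id _).symm
          simp
          rfl
      · exact (twoTermComplex S).shape _ _ (by simp)
      all_goals rfl
    | succ n =>
      rw [quasiIsoAt_iff_exactAt']
      · cases n with
        | zero =>
          have := hS.mono_f
          have : Mono ((twoTermComplex S).d 1 0) := by
            rw [twoTermComplex_d]; infer_instance
          exact ChainComplex.exactAt_one_of_mono (isZero_twoTermComplex_X S 0)
        | succ n => exact ChainComplex.exactAt_of_isZero (isZero_twoTermComplex_X S n)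
      · apply ChainComplex.exactAt_succ_single_obj⟩

/-- If `0 ⟶ X₁ ⟶ X₂ ⟶ X₃ ⟶ 0` is exact with `X₁` and `X₂` projective and `F` keeps `X₁ ⟶ X₂` a
monomorphism, then the higher left derived functors of `F` vanish at `X₃`. -/
lemma isZero_leftDerived_of_shortExact {D : Type*} [Category* D] [Abelian D]
    [HasProjectiveResolutions C] (F : C ⥤ D) [F.Additive]
    {S : ShortComplex C} (hS : S.ShortExact) [Projective S.X₁] [Projective S.X₂]
    [Mono (F.map S.f)] (n : ℕ) : IsZero ((F.leftDerived (n + 1)).obj S.X₃) := by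
  refine IsZero.of_iso ?_ ((twoTermResolution hS).isoLeftDerivedObj F (n + 1))
  refine (HomologicalComplex.exactAt_iff_isZero_homology _ _).1 ?_
  have hz (n : ℕ) : IsZero (((F.mapHomologicalComplex _).obj (twoTermComplex S)).X (n + 2)) :=
    F.map_isZero (isZero_twoTermComplex_X S n)
  cases n with
  | zero =>
    have hd : Mono (F.map ((twoTermComplex S).d 1 0)) := by
      rw [twoTermComplex_d, F.map_comp, F.map_comp]
      infer_instance
    have : Mono (((F.mapHomologicalComplex _).obj (twoTermComplex S)).d 1 0) := hd
    exact ChainComplex.exactAt_one_of_mono (K := (F.mapHomologicalComplex _).obj (twoTermComplex S))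
      (hz 0)
  | succ n => exact ChainComplex.exactAt_of_isZero (hz n)

/-- Computed with the resolution `0 ⟶ A ⟶ A ⟶ A / a ⟶ 0`. -/
lemma isZero_tor_quotient_span_singleton {A : Type u} [CommRing A] {M : Type u}
    [AddCommGroup M] [Module A M] (a : A) (hA : ∀ x : A, a * x = 0 → x = 0)
    (hM : ∀ x : M, a • x = 0 → x = 0) (n : ℕ) :
    IsZero (((Tor (ModuleCat.{u} A) (n + 1)).obj (ModuleCat.of A M)).obj
      (ModuleCat.of A (A ⧸ Ideal.span {a}))) := by
  let S : ShortComplex (ModuleCat.{u} A) :=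
    .mk (ModuleCat.ofHom (LinearMap.lsmul A A a)) (ModuleCat.ofHom (Ideal.span {a}).mkQ) (by
      ext
      simp)
  have hS : S.ShortExact := by
    refine ModuleCat.shortComplex_shortExact S (fun x => ?_) ?_ (Ideal.span {a}).mkQ_surjective
    · refine (Ideal.Quotient.eq_zero_iff_mem (I := Ideal.span {a}) (a := x)).trans ?_
      rw [Ideal.mem_span_singleton]
      exact ⟨fun ⟨y, hy⟩ => ⟨y, hy.symm⟩, fun ⟨y, hy⟩ => ⟨y, hy.symm⟩⟩
    · exact (injective_iff_map_eq_zero (LinearMap.lsmul A A a)).2 hA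
  have : Projective S.X₁ := (IsProjective.iff_projective (R := A) A).1 inferInstance
  have : Projective S.X₂ := (IsProjective.iff_projective (R := A) A).1 inferInstance
  have : Mono (((MonoidalCategory.tensoringLeft _).obj (ModuleCat.of A M)).map S.f) := by
    rw [ModuleCat.mono_iff_injective]
    change Function.Injective (LinearMap.lTensor M (LinearMap.lsmul A A a))
    refine (injective_iff_map_eq_zero _).2 fun x hx => ?_
    have h : TensorProduct.rid A M (LinearMap.lTensor M (LinearMap.lsmul A A a) x) =
        a • TensorProduct.rid A M x := by
      clear hx
      induction x with
      | zero => simp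
      | add x y hx hy => simp_all
      | tmul m b => simp [mul_smul]
    rw [hx, map_zero] at h
    exact (TensorProduct.rid A M).map_eq_zero_iff.1 (hM _ h.symm)
  exact isZero_leftDerived_of_shortExact _ hS n

end TwoTerm

/-! ### Points of `Cont(S, ℤ_p)` modulo `p` -/

section PadicHom

variable {p : ℕ} [Fact p.Prime]

/-- Frobenius rigidity: if `x ≡ x ^ p` modulo `p` in `A`, then ring maps `A → ℤ_p` that agree
modulo `p` are equal. -/
lemma padicInt_ringHom_ext {A : Type*} [CommRing A] (hA : ∀ x : A, ∃ y, (p : A) * y = x - x ^ p)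
    (f g : A →+* ℤ_[p]) (h : ∀ x, (p : ℤ_[p]) ∣ f x - g x) : f = g := by
  have key (n : ℕ) : ∀ x, (p : ℤ_[p]) ^ (n + 1) ∣ f x - g x := by
    induction n with
    | zero => simpa using h
    | succ n ih =>
      intro x
      obtain ⟨y, hy⟩ := hA x
      -- `x = x ^ p + p * y`; taking `p`-th powers, like multiplying by `p`, improves a congruence
      -- modulo `p ^ (n + 1)` to one modulo `p ^ (n + 2)`
      have h1 : f x - g x = (f x ^ p - g x ^ p) + p * (f y - g y) := by
        have hf := congrArg f hy
        have hg := congrArg g hy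
        simp only [map_mul, map_natCast, map_sub, map_pow] at hf hg
        linear_combination hg - hf
      rw [h1]
      refine dvd_add ?_ (by rw [pow_succ']; exact mul_dvd_mul_left _ (ih y))
      have h2 : (p : ℤ_[p]) ∣ f x - g x := (dvd_pow_self _ (Nat.succ_ne_zero n)).trans (ih x)
      rw [← (Commute.all (f x) (g x)).geom_sum₂_mul p, pow_succ']
      exact mul_dvd_mul (dvd_geom_sum₂_self h2) (ih x)
  ext1 x
  rw [← sub_eq_zero, ← norm_le_zero_iff]
  refine le_of_forall_pos_le_add fun ε hε => ?_
  obtain ⟨n, hn⟩ := PadicInt.exists_pow_neg_lt p hε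
  rw [zero_add]
  refine ((PadicInt.norm_le_pow_iff_mem_span_pow _ n).2 ?_).trans hn.le
  exact Ideal.mem_span_singleton.2 ((pow_dvd_pow _ n.le_succ).trans (key n x))

variable {S T : Type u} [TopologicalSpace S] [TopologicalSpace T]

/-- Evaluation at `s`, modulo `p`. -/
def evalModP (s : S) : C(S, ℤ_[p]) →+* ZMod p :=
  PadicInt.toZMod.comp (ContinuousMap.evalAlgHom ℤ_[p] ℤ_[p] s : C(S, ℤ_[p]) →+* ℤ_[p])

lemma evalModP_eq_zero_iff (s : S) (f : C(S, ℤ_[p])) : evalModP s f = 0 ↔ (p : ℤ_[p]) ∣ f s := by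
  rw [← Ideal.mem_span_singleton, ← PadicInt.maximalIdeal_eq_span_p, ← PadicInt.ker_toZMod]
  rfl

lemma p_dvd_iff_evalModP (f : C(S, ℤ_[p])) :
    (p : C(S, ℤ_[p])) ∣ f ↔ ∀ s, evalModP s f = 0 := by
  simp_rw [evalModP_eq_zero_iff]
  refine ⟨fun ⟨g, hg⟩ s => ⟨g s, by rw [hg]; simp⟩, fun h => ?_⟩
  have hp : (p : ℚ_[p]) ≠ 0 := by exact_mod_cast (Fact.out : p.Prime).ne_zero
  have hn (s : S) : ‖(f s : ℚ_[p]) / p‖ ≤ 1 := by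
    obtain ⟨y, hy⟩ := h s
    rw [hy, PadicInt.coe_mul, PadicInt.coe_natCast, mul_div_cancel_left₀ _ hp]
    exact y.2
  refine ⟨⟨fun s => ⟨(f s : ℚ_[p]) / p, hn s⟩,
    Continuous.subtype_mk ((continuous_subtype_val.comp f.continuous).div_const _) _⟩, ?_⟩
  ext s
  apply Subtype.ext
  change (f s : ℚ_[p]) = ((p : ℤ_[p]) : ℚ_[p]) * ((f s : ℚ_[p]) / p)
  rw [PadicInt.coe_natCast, mul_div_cancel₀ _ hp]

/-- The point of `Spec (Cont(S, ℤ_p) / p)` given by `s`: the kernel of evaluation at `s` modulo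
`p`. -/
def pointModP (s : S) : PrimeSpectrum (C(S, ℤ_[p]) ⧸ DeltaRingCat.idealP p C(S, ℤ_[p])) :=
  PrimeSpectrum.comap (Ideal.Quotient.lift (DeltaRingCat.idealP p C(S, ℤ_[p])) (evalModP s)
    (fun a ha => by
      rw [Ideal.mem_span_singleton] at ha
      exact (p_dvd_iff_evalModP a).1 ha s)) ⊥

lemma mk_mem_pointModP_iff (s : S) (f : C(S, ℤ_[p])) :
    Ideal.Quotient.mk _ f ∈ (pointModP s).asIdeal ↔ evalModP s f = 0 := by
  rfl

lemma continuous_pointModP : Continuous (pointModP (p := p) (S := S)) := by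
  refine PrimeSpectrum.isTopologicalBasis_basic_opens.continuous_iff.2 ?_
  rintro _ ⟨a, rfl⟩
  obtain ⟨f, rfl⟩ := Ideal.Quotient.mk_surjective a
  -- the complement of the preimage is where `p` divides the value of `f`, a closed condition
  rw [← isClosed_compl_iff]
  have h : (pointModP ⁻¹' SetLike.coe (PrimeSpectrum.basicOpen (Ideal.Quotient.mk
      (DeltaRingCat.idealP p C(S, ℤ_[p])) f)))ᶜ =
      {s | ‖f s‖ ≤ (p : ℝ) ^ (-(1 : ℕ) : ℤ)} := by
    ext s
    rw [Set.mem_ofPred_eq, PadicInt.norm_le_pow_iff_mem_span_pow, pow_one,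
      Ideal.mem_span_singleton, ← evalModP_eq_zero_iff, ← mk_mem_pointModP_iff]
    exact not_not
  rw [h]
  exact isClosed_le (by fun_prop) continuous_const

/-- The `ℤ_p`-valued indicator function of a clopen set. -/
def indicatorCont (U : Set S) (hU : IsClopen U) : C(S, ℤ_[p]) :=
  ((LocallyConstant.charFn ℤ_[p] hU : LocallyConstant S ℤ_[p]) : C(S, ℤ_[p]))

lemma evalModP_indicatorCont (U : Set S) (hU : IsClopen U) (s : S) :
    evalModP s (indicatorCont (p := p) U hU) = 0 ↔ s ∉ U := by
  change PadicInt.toZMod (Set.indicator U 1 s : ℤ_[p]) = 0 ↔ s ∉ U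
  by_cases h : s ∈ U <;> simp [h]

variable (p S) in
lemma quotient_cont_pow_eq (a : C(S, ℤ_[p]) ⧸ DeltaRingCat.idealP p C(S, ℤ_[p])) : a ^ p = a := by
  obtain ⟨x, rfl⟩ := Ideal.Quotient.mk_surjective a
  rw [← map_pow, eq_comm, Ideal.Quotient.eq, Ideal.mem_span_singleton]
  exact ⟨(contDelta p S).toFun x, (contDelta_spec p S x).symm⟩

/-- Clopen indicators separate points. The image is closed, as the spectrum of a `p`-Boolean ring is
Hausdorff, and dense, as a function that vanishes modulo `p` at every point is divisible by `p`. -/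
lemma bijective_pointModP [CompactSpace S] [TotallySeparatedSpace S] :
    Function.Bijective (pointModP (p := p) (S := S)) := by
  constructor
  · intro s t hst
    by_contra hne
    obtain ⟨U, hU, hs, ht⟩ := exists_isClopen_of_totally_separated hne
    have h := (evalModP_indicatorCont (p := p) U hU t).2 ht
    rw [← mk_mem_pointModP_iff, ← hst, mk_mem_pointModP_iff, evalModP_indicatorCont] at h
    exact h hs
  · have := totallySeparatedSpace_primeSpectrum (quotient_cont_pow_eq p S)
    rw [← Set.range_eq_univ,
      ← (isCompact_range (continuous_pointModP (p := p) (S := S))).isClosed.closure_eq]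
    refine Dense.closure_eq (PrimeSpectrum.isTopologicalBasis_basic_opens.dense_iff.2 ?_)
    rintro _ ⟨a, rfl⟩ ⟨P, hP⟩
    obtain ⟨f, rfl⟩ := Ideal.Quotient.mk_surjective a
    by_contra hempty
    refine hP ?_
    rw [Ideal.Quotient.eq_zero_iff_mem.2]
    · exact P.asIdeal.zero_mem
    · rw [Ideal.mem_span_singleton, p_dvd_iff_evalModP]
      intro s
      by_contra hs
      exact hempty ⟨_, fun h => hs ((mk_mem_pointModP_iff s f).1 h), s, rfl⟩

end PadicHom

/-! ### Sites and equivalences -/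

section Sites

variable {C D : Type*} [Category* C] [Category* D]

lemma CategoryTheory.Precoverage.functorPushforward_mem_of_mem_toGrothendieck {F : C ⥤ D}
    [F.IsEquivalence] {P : Precoverage C} {K : GrothendieckTopology D}
    (h : ∀ (X : C), ∀ R ∈ P X, (Sieve.generate R).functorPushforward F ∈ K (F.obj X))
    {X : C} {R : Sieve X} (hR : R ∈ P.toGrothendieck X) :
    R.functorPushforward F ∈ K (F.obj X) := by
  have h1 : P.toGrothendieck ≤ F.inducedTopology K := by
    rw [Precoverage.toGrothendieck_le_iff_le_toPrecoverage]
    intro X R hR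
    rw [GrothendieckTopology.mem_toPrecoverage_iff, Functor.mem_inducedTopology_iff_of_isCoverDense]
    exact h X R hR
  exact (Functor.mem_inducedTopology_iff_of_isCoverDense _ _ _).1 (h1 X hR)

/-- It is enough that the functors of the equivalence send generating covers to covering sieves. -/
lemma isIsoOfSites_of_forall_mem (e : C ≌ D) {P : Precoverage C} {Q : Precoverage D}
    (h1 : ∀ X, ∀ R ∈ P X, (Sieve.generate R).functorPushforward e.functor ∈
      Q.toGrothendieck (e.functor.obj X))
    (h2 : ∀ Y, ∀ R ∈ Q Y, (Sieve.generate R).functorPushforward e.inverse ∈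
      P.toGrothendieck (e.inverse.obj Y)) :
    IsIsoOfSites e P.toGrothendieck Q.toGrothendieck := by
  refine ⟨fun X R =>
      ⟨Precoverage.functorPushforward_mem_of_mem_toGrothendieck h1, fun h => ?_⟩,
    fun Y R => ⟨Precoverage.functorPushforward_mem_of_mem_toGrothendieck h2, fun h => ?_⟩⟩
  · rw [← Sieve.pullback_functorPushforward_equivalence_eq e R]
    exact GrothendieckTopology.pullback_stable _ _
      (Precoverage.functorPushforward_mem_of_mem_toGrothendieck h2 h)
  · rw [← Sieve.pullback_functorPushforward_equivalence_eq e.symm R]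
    exact GrothendieckTopology.pullback_stable _ _
      (Precoverage.functorPushforward_mem_of_mem_toGrothendieck h1 h)

end Sites

/-! ### Completely faithfully flat covers -/

section Cover

variable {A : Type u} [CommRing A] {ι : Type} {B : ι → Type u} [∀ i, CommRing (B i)]

/-- Since a prime of the finite product of the rings `B i` comes from one of the factors,
surjectivity on spectra of `A / I → (∏ i, B i) / I` is joint surjectivity of the spectra
of the `B i / I`. -/
lemma surjective_comap_quotientMap_pi_iff [Finite ι] (I : Ideal A) (J : ∀ i, Ideal (B i))
    (f : ∀ i, A →+* B i) (hIJ : ∀ i, I ≤ (J i).comap (f i)) (hJ : ∀ i, J i ≤ I.map (f i)) :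
    Function.Surjective (PrimeSpectrum.comap
      (Ideal.quotientMap (I.map (RingHom.pi f)) (RingHom.pi f) Ideal.le_comap_map)) ↔
    ∀ P : PrimeSpectrum (A ⧸ I), ∃ i, ∃ Q : PrimeSpectrum (B i ⧸ J i),
      PrimeSpectrum.comap (Ideal.quotientMap (J i) (f i) (hIJ i)) Q = P := by
  constructor
  · intro h P
    obtain ⟨Q, rfl⟩ := h P
    obtain ⟨⟨i, q⟩, hq⟩ := (PrimeSpectrum.sigmaToPi_bijective B).2
      (PrimeSpectrum.comap (Ideal.Quotient.mk _) Q)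
    have hJq : J i ≤ q.asIdeal := by
      refine (hJ i).trans (Ideal.map_le_iff_le_comap.2 fun a ha => ?_)
      have h1 : RingHom.pi f a ∈ (PrimeSpectrum.sigmaToPi B ⟨i, q⟩).asIdeal := by
        rw [hq]
        change Ideal.Quotient.mk _ (RingHom.pi f a) ∈ Q.asIdeal
        rw [Ideal.Quotient.eq_zero_iff_mem.2 (Ideal.mem_map_of_mem _ ha)]
        exact Q.asIdeal.zero_mem
      exact h1
    obtain ⟨q', hq'⟩ : q ∈ Set.range (PrimeSpectrum.comap (Ideal.Quotient.mk (J i))) := by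
      rw [range_comap_of_surjective _ _ Ideal.Quotient.mk_surjective, Ideal.mk_ker]
      exact hJq
    refine ⟨i, q', PrimeSpectrum.comap_injective_of_surjective _
      Ideal.Quotient.mk_surjective ?_⟩
    have h3 : PrimeSpectrum.comap (f i) q = PrimeSpectrum.comap (RingHom.pi f)
      (PrimeSpectrum.sigmaToPi B ⟨i, q⟩) := rfl
    rw [hq, ← hq'] at h3
    exact h3
  · intro h P
    obtain ⟨i, Q, rfl⟩ := h P
    refine ⟨PrimeSpectrum.comap (Ideal.quotientMap (J i) (Pi.evalRingHom B i)
      (Ideal.map_le_iff_le_comap.2 (hIJ i))) Q, ?_⟩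
    refine PrimeSpectrum.comap_injective_of_surjective _ Ideal.Quotient.mk_surjective ?_
    rfl

end Cover

section StoneCover

variable {p : ℕ} [Fact p.Prime]

/-- The flatness conditions are automatic: Stone `δ`-rings are `p`-torsion-free, so the `Tor` groups
vanish, and their reductions modulo `p` are `p`-Boolean, over which every module is flat. -/
lemma isPCompletelyFaithfullyFlatCover_iff {ι : Type} [Finite ι] {X : (StoneDelta.{u} p)ᵒᵖ}
    {Y : ι → (StoneDelta.{u} p)ᵒᵖ} (f : ∀ i, Y i ⟶ X) :
    IsPCompletelyFaithfullyFlatCover f ↔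
      ∀ P : ((StoneDelta.incl p).op ⋙ DeltaRingCat.specModP p).obj X,
        ∃ i, ∃ Q : ((StoneDelta.incl p).op ⋙ DeltaRingCat.specModP p).obj (Y i),
          ((StoneDelta.incl p).op ⋙ DeltaRingCat.specModP p).map (f i) Q = P := by
  refine (and_iff_right ?_).trans ((RingHom.faithfullyFlat_iff_of_pow_eq (p := p)
    X.unop.quotient_pow_eq _).trans
      (surjective_comap_quotientMap_pi_iff _ (fun i => DeltaRingCat.idealP p _) _ ?_ ?_))
  · intro n
    let := (RingHom.pi fun i => StoneDelta.ringHom p (f i)).toAlgebra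
    refine isZero_tor_quotient_span_singleton (p : X.unop.obj.obj) X.unop.torsionFree
      (fun x hx => ?_) n
    rw [Algebra.smul_def, map_natCast] at hx
    funext i
    exact (Y i).unop.torsionFree _ (congrFun hx i)
  · intro i
    simp [DeltaRingCat.idealP, Ideal.span_le]
  · intro i
    simp [DeltaRingCat.idealP, Ideal.map_span]

end StoneCover

/-! ### The equivalence with profinite sets -/

section Profinite

variable (p : ℕ) [Fact p.Prime]

/-- The homeomorphism of a profinite set `S` with `Spec (Cont(S, ℤ_p) / p)`. -/
def homeoModP (S : Profinite.{u}) :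
    S ≃ₜ PrimeSpectrum (C(S, ℤ_[p]) ⧸ DeltaRingCat.idealP p C(S, ℤ_[p])) :=
  have := totallySeparatedSpace_primeSpectrum (quotient_cont_pow_eq p S)
  Continuous.homeoOfEquivCompactToT2
    (f := Equiv.ofBijective (pointModP (p := p) (S := S)) bijective_pointModP) continuous_pointModP

/-- The homeomorphisms `homeoModP`, naturally in `S`. -/
def toTopCatIsoSpecModP :
    Profinite.toTopCat.{u} ≅ contFunctor p ⋙ DeltaRingCat.specModP p :=
  NatIso.ofComponents (fun S => TopCat.isoOfHomeo (homeoModP p S)) fun {S T} f => by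
    ext s
    refine PrimeSpectrum.comap_injective_of_surjective _ Ideal.Quotient.mk_surjective ?_
    rfl

instance : (contFunctor.{u} p).Faithful where
  map_injective {S T} f g h := by
    ext s
    by_contra hne
    obtain ⟨U, hU, hs, ht⟩ := exists_isClopen_of_totally_separated hne
    have h1 := congrArg (fun k => DeltaRingCat.Hom.hom k.unop (indicatorCont U hU)) h
    have h2 := (evalModP_indicatorCont (p := p) U hU (g s)).2 ht
    refine (evalModP_indicatorCont (p := p) U hU (f s)).1 ?_ hs
    rw [← h2]
    exact congrArg (fun k : C(S, ℤ_[p]) => evalModP s k) h1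

/-- A map `φ : Cont(T, ℤ_p) → Cont(S, ℤ_p)` induces a continuous map `f : S → T` on the spectra
modulo `p`. Evaluation at `f s`, and `φ` followed by evaluation at `s`, agree modulo `p`, hence
agree by `padicInt_ringHom_ext`. -/
instance : (contFunctor.{u} p).Full where
  map_surjective {S T} φ := by
    let ψ : C(T, ℤ_[p]) →+* C(S, ℤ_[p]) := DeltaRingCat.Hom.hom φ.unop
    let m : C(PrimeSpectrum (C(S, ℤ_[p]) ⧸ DeltaRingCat.idealP p C(S, ℤ_[p])),
        PrimeSpectrum (C(T, ℤ_[p]) ⧸ DeltaRingCat.idealP p C(T, ℤ_[p]))) :=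
      ((DeltaRingCat.specModP p).map φ).hom
    let f : C(S, T) := ((homeoModP p T).symm : C(_, T)).comp (m.comp (homeoModP p S : C(S, _)))
    have hf (s : S) : pointModP (p := p) (f s) = m (pointModP s) :=
      (homeoModP p T).apply_symm_apply _
    have h0 (s : S) (g : C(T, ℤ_[p])) : evalModP (f s) g = 0 ↔ evalModP s (ψ g) = 0 := by
      rw [← mk_mem_pointModP_iff, hf]
      rfl
    have h1 (s : S) : (ContinuousMap.evalAlgHom ℤ_[p] ℤ_[p] (f s) : C(T, ℤ_[p]) →+* ℤ_[p]) =
        (ContinuousMap.evalAlgHom ℤ_[p] ℤ_[p] s : C(S, ℤ_[p]) →+* ℤ_[p]).comp ψ := by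
      refine padicInt_ringHom_ext (fun x => ⟨_, contDelta_spec p T x⟩) _ _ fun g => ?_
      -- a constant with the same residue as `g` at `f s` reduces the congruence to one of zeros
      obtain ⟨n, hn⟩ := ZMod.natCast_zmod_surjective (evalModP (f s) g)
      have h2 : evalModP (f s) (g - (n : C(T, ℤ_[p]))) = 0 := by simp [hn]
      have h3 := (h0 s _).1 h2
      rw [evalModP_eq_zero_iff] at h2 h3
      have h4 := dvd_sub h2 h3
      simpa using h4
    refine ⟨CompHausLike.ofHom _ f, Quiver.Hom.unop_inj (DeltaRingCat.Hom.ext ?_)⟩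
    exact RingHom.ext fun g => ContinuousMap.ext fun s => RingHom.congr_fun (h1 s) g

instance : (contStone.{u} p).Faithful :=
  have : (contStone p ⋙ (StoneDelta.incl p).op).Faithful := .of_iso (contStoneCompIncl p).symm
  .of_comp _ (StoneDelta.incl p).op

instance : (contStone.{u} p).Full :=
  .of_comp_faithful_iso (contStoneCompIncl p)

instance : (contStone.{u} p).IsEquivalence where

/-- The equivalence `S ↦ Cont(S, ℤ_p)` of profinite sets with the opposite of Stone `δ`-rings. -/
def profiniteEquivStoneDelta : Profinite.{u} ≌ (StoneDelta.{u} p)ᵒᵖ :=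
  (contStone p).asEquivalence

/-- The inverse of `profiniteEquivStoneDelta` is `A ↦ Spec (A / p)` on underlying spaces. -/
def inverseIsoSpecModP : (profiniteEquivStoneDelta p).inverse ⋙ Profinite.toTopCat.{u} ≅
    (StoneDelta.incl p).op ⋙ DeltaRingCat.specModP p :=
  let e := profiniteEquivStoneDelta.{u} p
  Functor.isoWhiskerLeft e.inverse (toTopCatIsoSpecModP p ≪≫
      Functor.isoWhiskerRight (contStoneCompIncl p).symm (DeltaRingCat.specModP p)) ≪≫
    Functor.isoWhiskerRight e.counitIso ((StoneDelta.incl p).op ⋙ DeltaRingCat.specModP p)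

lemma jointlySurjective_iff_of_natIso {C : Type*} [Category* C] {F G : C ⥤ TopCat.{u}} (e : F ≅ G)
    {ι : Type} {X : C} {Y : ι → C} (f : ∀ i, Y i ⟶ X) :
    (∀ x : F.obj X, ∃ i, ∃ y : F.obj (Y i), F.map (f i) y = x) ↔
      ∀ x : G.obj X, ∃ i, ∃ y : G.obj (Y i), G.map (f i) y = x := by
  have aux {F G : C ⥤ TopCat.{u}} (e : F ≅ G)
      (h : ∀ x : F.obj X, ∃ i, ∃ y : F.obj (Y i), F.map (f i) y = x) (x : G.obj X) :
      ∃ i, ∃ y : G.obj (Y i), G.map (f i) y = x := by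
    obtain ⟨i, y, hy⟩ := h (e.inv.app X x)
    refine ⟨i, e.hom.app (Y i) y, ?_⟩
    rw [← NatTrans.naturality_apply, hy]
    simp
  exact ⟨aux e, aux e.symm⟩

lemma isJointlySurjective_iff {ι : Type} [Finite ι] {S : Profinite.{u}} {T : ι → Profinite.{u}}
    (f : ∀ i, T i ⟶ S) : IsJointlySurjective f ↔
      IsPCompletelyFaithfullyFlatCover fun i => (contStone p).map (f i) := by
  rw [isPCompletelyFaithfullyFlatCover_iff]
  exact jointlySurjective_iff_of_natIso (toTopCatIsoSpecModP p ≪≫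
      Functor.isoWhiskerRight (contStoneCompIncl p).symm (DeltaRingCat.specModP p)) f

lemma isPCompletelyFaithfullyFlatCover_iff_inverse {ι : Type} [Finite ι] {X : (StoneDelta.{u} p)ᵒᵖ}
    {Y : ι → (StoneDelta.{u} p)ᵒᵖ} (f : ∀ i, Y i ⟶ X) :
    IsPCompletelyFaithfullyFlatCover f ↔
      IsJointlySurjective fun i => (profiniteEquivStoneDelta p).inverse.map (f i) := by
  rw [isPCompletelyFaithfullyFlatCover_iff]
  exact (jointlySurjective_iff_of_natIso (inverseIsoSpecModP p) f).symm

lemma isIsoOfSites_profinite :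
    IsIsoOfSites (profiniteEquivStoneDelta.{u} p) tauEff (tauPfpqc p) := by
  refine isIsoOfSites_of_forall_mem _ ?_ ?_
  · rintro X _ ⟨ι, _, T, f, rfl, hf⟩
    rw [← Sieve.ofArrows, Sieve.functorPushforward_ofArrows]
    exact Precoverage.generate_mem_toGrothendieck
      ⟨ι, ‹_›, _, _, rfl, (isJointlySurjective_iff p f).1 hf⟩
  · rintro X _ ⟨ι, _, T, f, rfl, hf⟩
    rw [← Sieve.ofArrows, Sieve.functorPushforward_ofArrows]
    exact Precoverage.generate_mem_toGrothendieck
      ⟨ι, ‹_›, _, _, rfl, (isPCompletelyFaithfullyFlatCover_iff_inverse p f).1 hf⟩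

end Profinite

end

theorem mainTheorem2 (p : ℕ) [Fact p.Prime] :
    (∃ e : Profinite.{u} ≌ (StoneDelta.{u} p)ᵒᵖ,
      Nonempty (e.functor ⋙ (StoneDelta.incl p).op ≅ contFunctor p) ∧
      Nonempty (e.inverse ⋙ Profinite.toTopCat ≅
        (StoneDelta.incl p).op ⋙ DeltaRingCat.specModP p) ∧
      IsIsoOfSites e tauEff (tauPfpqc p) ∧
      (∀ (ι : Type) [Finite ι] (S : Profinite.{u}) (T : ι → Profinite.{u}) (f : ∀ i, T i ⟶ S),
        IsJointlySurjective f ↔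
          IsPCompletelyFaithfullyFlatCover fun i => e.functor.map (f i))) ∧
    (∀ (A B : CommAlgCat.{u} (ZMod p)) (f : A ⟶ B),
      isStoneAlgebra (ZMod p) A → isStoneAlgebra (ZMod p) B →
        ((f.hom : A →+* B).FaithfullyFlat ↔
          Function.Surjective (PrimeSpectrum.comap (f.hom : A →+* B)))) :=
  ⟨⟨profiniteEquivStoneDelta p, ⟨contStoneCompIncl p⟩, ⟨inverseIsoSpecModP p⟩,
    isIsoOfSites_profinite p, fun _ _ _ _ f => isJointlySurjective_iff p f⟩,
    fun _ _ _ hA _ => RingHom.faithfullyFlat_iff_of_pow_eq hA.pow_eq _⟩
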